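/- Let $N$ be a finite set of players; let each player $i\in N$ have a nonempty finite set $S_i$ of pure strategies and a payoff function $u_i:\prod_{j\in N}S_j\to\mathbb{R}$. For sets $A,B\subseteq\mathbb{R}$ write $A\preccurlyeq B$ if $A=B$ or $x\le y$ for all $x\in A$, $y\in B$. A coarse-grained partition of $(\mathbb{R},\le)$ is a family of subsets of $\mathbb{R}$ (grains) on which $\preccurlyeq$ is a total order and such that every real number lies in exactly one grain. Let each player $k$ have a coarse-grained partition $\mathfrak{G}_k$ of $(\mathbb{R},\le)$, with coarse-graining function $\varphi_k:\mathbb{R}\to\mathfrak{G}_k$ sending $x$ to the grain that contains $x$, and a preprocessing map $\psi_k:\mathfrak{G}_k\to\mathbb{R}$. Entropy-maximizing preprocessing (EMP) applies to nonempty finite sets of reals and to bounded intervals with endpoints $a<b$ (open, half-open or closed); it sends a set to the expected value of the uniform distribution on it, i.e. a finite set to its arithmetic mean (so $\{x\}\mapsto x$) and an interval to $\frac{1}{b-a}\int_a^b x\,dx=\frac{a+b}{2}$. Suppose all players employ EMP: for every player $k$, EMP applies to every grain $\varphi_k(u_l(s))$ with $l\in N$, $s\in\prod_j S_j$, and $\psi_k$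 coincides with EMP on all grains of $\mathfrak{G}_k$ to which EMP applies. The preprocessed matrix $M'_k$ of player $k$ assigns to a strategy profile $s$ the payoffs $\bigl(\psi_k(\varphi_k(u_l(s)))\bigr)_{l\in N}$. Then for every player $k$ the finite game with payoff matrix $M'_k$ has at least one mixed-strategy Nash equilibrium: there are probability vectors $p_i$ on $S_i$ ($i\in N$) such that for every player $l$ and every probability vector $q$ on $S_l$, replacing $p_l$ by $q$ and keeping the other $p_i$ does not increase the expected payoff $$\sum_{s}\Bigl(\prod_{i\in N}p_i(s_i)\Bigr)\,\psi_k(\varphi_k(u_l(s)))$$ of player $l$. -/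

import Mathlib

/-- The element-wise ordering on sets of elements of a totally ordered set: every element of `A`
lies below every element of `B`. The clause `A = B` makes the relation reflexive, so that it can be
a total order on a family having members with more than one element. -/
def ElementwiseLE {U : Type*} [LinearOrder U] (A B : Set U) : Prop :=
  A = B ∨ ∀ x ∈ A, ∀ y ∈ B, x ≤ y

/-- A coarse-grained partition of a totally ordered set `U`: a family of subsets of `U` (its
grains) that is totally ordered by the element-wise ordering and such that every element of `U`
lies in exactly one grain. -/
structure CoarsePartition (U : Type*) [LinearOrder U] where
  grains : Set (Set U)
  le_refl : ∀ A ∈ grains, ElementwiseLE A A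
  le_antisymm : ∀ A ∈ grains, ∀ B ∈ grains, ElementwiseLE A B → ElementwiseLE B A → A = B
  le_trans : ∀ A ∈ grains, ∀ B ∈ grains, ∀ C ∈ grains,
    ElementwiseLE A B → ElementwiseLE B C → ElementwiseLE A C
  le_total : ∀ A ∈ grains, ∀ B ∈ grains, ElementwiseLE A B ∨ ElementwiseLE B A
  existsUnique_grain : ∀ x : U, ∃! G : Set U, G ∈ grains ∧ x ∈ G

/-- The coarse-graining function `φ` of a coarse-grained partition: it sends a point to the unique
grain that contains it. -/
noncomputable def CoarsePartition.coarsen {U : Type*} [LinearOrder U] (P : CoarsePartition U)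
    (x : U) : P.grains :=
  ⟨(P.existsUnique_grain x).choose, (P.existsUnique_grain x).choose_spec.1.1⟩

/-- The defining property of the coarse-graining function. -/
theorem CoarsePartition.mem_coarsen {U : Type*} [LinearOrder U] (P : CoarsePartition U)
    (x : U) : x ∈ (P.coarsen x : Set U) :=
  (P.existsUnique_grain x).choose_spec.1.2

/-- The sets of real numbers to which entropy-maximizing preprocessing applies: nonempty finite
sets (in particular singletons) and bounded nondegenerate intervals of any of the four kinds. -/
def EMPApplicable (G : Set ℝ) : Prop :=
  (G.Nonempty ∧ G.Finite) ∨
    ∃ a b : ℝ, a < b ∧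
      (G = Set.Ioo a b ∨ G = Set.Ioc a b ∨ G = Set.Ico a b ∨ G = Set.Icc a b)

open Classical in
/-- The value of entropy-maximizing preprocessing on `G`: the expected value of the uniform
distribution on `G`, that is, the arithmetic mean of a finite set and the average of `x` over an
interval with respect to Lebesgue measure. Meaningful when `EMPApplicable G`. -/
noncomputable def empValue (G : Set ℝ) : ℝ :=
  if h : G.Finite then (∑ x ∈ h.toFinset, x) / (h.toFinset.card : ℝ)
  else MeasureTheory.average (MeasureTheory.volume.restrict G) (fun x : ℝ => x)

/-- A coarse-grained game with player set `ι` and strategy sets `S i`: real payoff functions `u`, a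
coarse-grained partition of the real line for every player, and a preprocessing map from the grains
to the real numbers for every player. The coarse-graining functions are determined by the
partitions, see `CoarseGrainedGame.phi`. -/
structure CoarseGrainedGame (ι : Type*) (S : ι → Type*) where
  u : ι → (∀ i, S i) → ℝ
  partition : ι → CoarsePartition ℝ
  psi : ∀ k, (partition k).grains → ℝ

/-- The coarse-graining function of player `k`. -/
noncomputable def CoarseGrainedGame.phi {ι : Type*} {S : ι → Type*} (g : CoarseGrainedGame ι S)
    (k : ι) : ℝ → (g.partition k).grains :=
  (g.partition k).coarsen

/-- The base payoff matrix: the cell of a strategy profile lists the payoffs of all players. -/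
def CoarseGrainedGame.baseMatrix {ι : Type*} {S : ι → Type*} (g : CoarseGrainedGame ι S) :
    (∀ i, S i) → ι → ℝ :=
  fun s l => g.u l s

/-- The coarse-grained payoff matrix of player `k`: the payoffs of all players, seen through the
partition of player `k`. -/
noncomputable def CoarseGrainedGame.coarseMatrix {ι : Type*} {S : ι → Type*}
    (g : CoarseGrainedGame ι S) (k : ι) : (∀ i, S i) → ι → (g.partition k).grains :=
  fun s l => g.phi k (g.baseMatrix s l)

/-- The preprocessed payoff matrix `M'` of player `k`. -/
noncomputable def CoarseGrainedGame.preprocessedMatrix {ι : Type*} {S : ι → Type*}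
    (g : CoarseGrainedGame ι S) (k : ι) : (∀ i, S i) → ι → ℝ :=
  fun s l => g.psi k (g.coarseMatrix k s l)

/-- All players employ entropy-maximizing preprocessing: it applies to every grain occurring in
the coarse-grained matrix of a player, and the preprocessing map of the player is given by it on
all grains to which it applies. -/
def CoarseGrainedGame.UsesEMP {ι : Type*} {S : ι → Type*} (g : CoarseGrainedGame ι S) : Prop :=
  (∀ (k : ι) (s : ∀ i, S i) (l : ι), EMPApplicable (g.coarseMatrix k s l : Set ℝ)) ∧
    ∀ (k : ι) (G : (g.partition k).grains),
      EMPApplicable (G : Set ℝ) → g.psi k G = empValue (G : Set ℝ)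

/-- The expected payoff of player `l` in the payoff matrix `M` when every player `i` independently
plays the pure strategy `t` with probability `σ i t`. -/
noncomputable def expectedPayoff {ι : Type*} [Fintype ι] [DecidableEq ι] {S : ι → Type*}
    [∀ i, Fintype (S i)] (M : (∀ i, S i) → ι → ℝ) (σ : ∀ i, S i → ℝ) (l : ι) : ℝ :=
  ∑ s : (∀ i, S i), (∏ i, σ i (s i)) * M s l

/-- `σ` is a mixed-strategy Nash equilibrium of the payoff matrix `M`: every `σ i` is a probability
vector on the strategies of player `i`, and no player can increase the own expected payoff by a
unilateral change of mixed strategy. -/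
def IsMixedNashEquilibrium {ι : Type*} [Fintype ι] [DecidableEq ι] {S : ι → Type*}
    [∀ i, Fintype (S i)] (M : (∀ i, S i) → ι → ℝ) (σ : ∀ i, S i → ℝ) : Prop :=
  (∀ i, σ i ∈ stdSimplex ℝ (S i)) ∧
    ∀ (l : ι) (τ : S l → ℝ), τ ∈ stdSimplex ℝ (S l) →
      expectedPayoff M (Function.update σ l τ) l ≤ expectedPayoff M σ l

/-!
Every finite game with real payoffs has a mixed Nash equilibrium, and a preprocessed matrix is such
a game, whatever the partitions and the preprocessing maps are; so the content is Nash's theorem,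
and behind it Brouwer's fixed point theorem, which is proved here from Scarf's combinatorial lemma.

*Scarf's lemma* (`exists_dominant_colored`). Let `T` be finite, with one preorder for every index
`i : I` and a colouring `T → I`. Then some `σ : Finset T` is such that no point of `T` exceeds, in
all the preorders belonging to the colours of `σ` simultaneously, the respective minimum of `σ`.
For the proof, ties are broken and one slack element per index is added to `T`, which makes all
relevant sets equal in size. Dominant sets of `card I` elements ("rooms") and dominant
sets with one element less that carry exactly the colours other than a fixed `i₀` ("doors") are then
counted as in Sperner's lemma: a door lies in exactly two rooms
(`even_card_filter_insert_dominant`), except that the door made of slack elements lies in one; a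
room has an odd number of doors if and only if it carries all colours
(`odd_card_filter_erase_image_iff`). Hence a room with all colours exists.

*Brouwer's theorem.* Take for `T` the points of the simplex with coordinates in `ℕ / N`, ordered by
each coordinate, and colour `x` by an `i` with `x i ≤ f x i`. The lemma gives a set of diameter
`O(1 / N)` on which every coordinate is either nearly zero or has a colour occurring in the set. In
the limit this is a point `a` with `a i ≤ f a i` for all `i`, so `f a = a`, both having sum one.
A product of simplices is a retract of a simplex, which gives fixed points there.

*Nash's theorem.* At a fixed point of Nash's map, which moves the weight of every player towards the
pure strategies that improve on the present payoff, no pure strategy improves on it, and therefore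
no mixed strategy does.
-/

/-! ### Scarf's combinatorial lemma -/

section Scarf

variable {V I L : Type*}

/-- `X` is dominant for the family of orders given by the keys `κ i` if no point lies strictly
above the `κ i`-minimum of `X` for all `i` at once. The minimum is not mentioned, so that the
condition makes sense for empty `X` too. -/
def IsDominant [LE L] (κ : I → V → L) (X : Finset V) : Prop :=
  ∀ y, ∃ i, ∀ x ∈ X, κ i y ≤ κ i x

theorem IsDominant.mono [LE L] {κ : I → V → L} {X Y : Finset V} (hY : IsDominant κ Y) (h : X ⊆ Y) :
    IsDominant κ X := fun y => (hY y).imp fun _ hi x hx => hi x (h hx)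

/-- A dominant set `X` with one element less than there are indices has exactly two one-point
extensions that are again dominant. As every element of `X` is the minimum for some index, exactly
two indices `a` and `b` share their minimum; an extension by `v` is dominant if and only if, for
`j = a` or `j = b`, `v` is the `κ j`-largest among the points that lie above the minima of all
indices other than `j`. The points `e j` guarantee that such points exist. -/
theorem even_card_filter_insert_dominant [LinearOrder L] [Fintype V] [Fintype I]
    [DecidableEq V] [DecidableEq I] {κ : I → V → L} (hκ : ∀ i, Function.Injective (κ i)) {X : Finset V}
    [DecidablePred fun v => v ∉ X ∧ IsDominant κ (insert v X)]
    (hX : IsDominant κ X) (hcard : X.card + 1 = Fintype.card I) {t : V} (ht : t ∈ X)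
    (e : I → V) (he : ∀ i a, i ≠ a → κ i t < κ i (e a)) :
    Even (Finset.univ.filter fun v => v ∉ X ∧ IsDominant κ (insert v X)).card := by
  classical
  have hne : X.Nonempty := ⟨t, ht⟩
  choose m hmX hm using fun i => Finset.exists_min_image X (κ i) hne
  have hsurj : ∀ x ∈ X, ∃ i, m i = x := fun x hx => by
    obtain ⟨i, hi⟩ := hX x
    exact ⟨i, hκ i (le_antisymm (hm i x hx) (hi _ (hmX i)))⟩
  obtain ⟨a, -, b, -, hab, hmab⟩ := Finset.exists_ne_map_eq_of_card_lt_of_maps_to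
    (s := (Finset.univ : Finset I)) (t := X) (f := m)
    (by rw [Finset.card_univ]; omega) (fun i _ => hmX i)
  have hcov : ∀ j ∈ ({a, b} : Finset I), ∀ x ∈ X, ∃ i, i ≠ j ∧ m i = x := by
    intro j hj x hx
    obtain ⟨i, hi⟩ := hsurj x hx
    rcases eq_or_ne i j with rfl | hij
    · rcases Finset.mem_insert.1 hj with rfl | hj
      · exact ⟨b, hab.symm, hmab ▸ hi⟩
      · obtain rfl := Finset.mem_singleton.1 hj
        exact ⟨a, hab, hmab ▸ hi⟩
    · exact ⟨i, hij, hi⟩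
  let P : I → Finset V := fun j => Finset.univ.filter fun v => ∀ i, i ≠ j → κ i (m i) < κ i v
  have hP : ∀ j v, v ∈ P j ↔ ∀ i, i ≠ j → κ i (m i) < κ i v := fun j v => by simp [P]
  have hPne : ∀ j, (P j).Nonempty := fun j =>
    ⟨e j, (hP _ _).2 fun i hij => (hm i t ht).trans_lt (he i j hij)⟩
  choose w hwP hw using fun j => Finset.exists_max_image (P j) (κ j) (hPne j)
  have key : ∀ v, (v ∉ X ∧ IsDominant κ (insert v X)) ↔ v ∈ ({w a, w b} : Finset V) := by
    intro v
    constructor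
    · rintro ⟨hv, hdom⟩
      obtain ⟨j, hj⟩ := hdom v
      have hjlt : ∀ x ∈ X, κ j v < κ j x := fun x hx =>
        lt_of_le_of_ne (hj x (Finset.mem_insert_of_mem hx)) fun h => hv (hκ j h ▸ hx)
      -- Every element of `X` stays a minimum after the insertion of `v`, so the indices in `J`,
      -- those whose minimum is unaffected, number at least `card X`: they are all but `j`.
      let J := Finset.univ.filter fun i => κ i (m i) < κ i v
      have hJX : X ⊆ J.image m := by
        intro x hx
        obtain ⟨i, hi⟩ := hdom x
        have h1 : m i = x :=
          hκ i (le_antisymm (hm i x hx) (hi _ (Finset.mem_insert_of_mem (hmX i))))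
        refine Finset.mem_image.2 ⟨i, ?_, h1⟩
        simp only [J, Finset.mem_filter, Finset.mem_univ, true_and, h1]
        exact lt_of_le_of_ne (hi v (Finset.mem_insert_self _ _)) fun h => hv (hκ i h ▸ hx)
      have hJj : J ⊆ Finset.univ.erase j := fun i hi => by
        refine Finset.mem_erase.2 ⟨?_, Finset.mem_univ _⟩
        rintro rfl
        exact lt_asymm (hjlt _ (hmX i)) (Finset.mem_filter.1 hi).2
      have hc1 : (Finset.univ.erase j).card = X.card := by
        rw [Finset.card_erase_of_mem (Finset.mem_univ _), Finset.card_univ]; omega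
      have hc2 := Finset.card_le_card hJX
      have hJ : J = Finset.univ.erase j :=
        Finset.eq_of_subset_of_card_le hJj (by rw [hc1]; exact hc2.trans Finset.card_image_le)
      have hvP : v ∈ P j := (hP _ _).2 fun i hij => by
        have : i ∈ J := by rw [hJ]; exact Finset.mem_erase.2 ⟨hij, Finset.mem_univ _⟩
        exact (Finset.mem_filter.1 this).2
      have hmax : v = w j := by
        refine hκ j (le_antisymm (hw j v hvP) ?_)
        obtain ⟨i, hi⟩ := hdom (w j)
        rcases eq_or_ne i j with rfl | hij
        · exact hi v (Finset.mem_insert_self _ _)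
        · exact absurd ((hP _ _).1 (hwP j) i hij)
            (not_lt.2 (hi _ (Finset.mem_insert_of_mem (hmX i))))
      have hinj : Set.InjOn m (J : Set I) := by
        refine Finset.injOn_of_card_image_eq (le_antisymm Finset.card_image_le ?_)
        rw [hJ, hc1, ← hJ]; exact hc2
      have hjab : j = a ∨ j = b := by
        by_contra! h
        refine hab (hinj ?_ ?_ hmab) <;> rw [hJ]
        · simpa using h.1.symm
        · simpa using h.2.symm
      rcases hjab with rfl | rfl <;> simp [hmax]
    · intro hv
      obtain ⟨j, hj, rfl⟩ : ∃ j ∈ ({a, b} : Finset I), v = w j := by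
        simp only [Finset.mem_insert, Finset.mem_singleton] at hv
        rcases hv with rfl | rfl
        · exact ⟨a, by simp, rfl⟩
        · exact ⟨b, by simp, rfl⟩
      have hwj := (hP _ _).1 (hwP j)
      have hle : ∀ x ∈ X, κ j (w j) ≤ κ j x := by
        obtain ⟨i, hi⟩ := hX (w j)
        rcases eq_or_ne i j with rfl | hij
        · exact hi
        · exact absurd (hwj i hij) (not_lt.2 (hi _ (hmX i)))
      refine ⟨fun hmem => ?_, fun y => ?_⟩
      · obtain ⟨i, hij, hi⟩ := hcov j hj _ hmem
        exact (hwj i hij).ne (by rw [hi])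
      · by_cases hy : y ∈ P j
        · refine ⟨j, fun x hx => ?_⟩
          rcases Finset.mem_insert.1 hx with rfl | hx
          · exact hw j y hy
          · exact (hw j y hy).trans (hle x hx)
        · rw [hP] at hy
          push Not at hy
          obtain ⟨i, hij, hi⟩ := hy
          refine ⟨i, fun x hx => ?_⟩
          rcases Finset.mem_insert.1 hx with rfl | hx
          · exact hi.trans (hwj i hij).le
          · exact hi.trans (hm i x hx)
  have hwne : w a ≠ w b := by
    intro h
    obtain ⟨i, hi⟩ := hX (w a)
    rcases eq_or_ne i a with rfl | hia
    · exact absurd ((hP _ _).1 (h ▸ hwP b) i hab) (not_lt.2 (hi _ (hmX i)))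
    · exact absurd ((hP _ _).1 (hwP a) i hia) (not_lt.2 (hi _ (hmX i)))
  have : (Finset.univ.filter fun v => v ∉ X ∧ IsDominant κ (insert v X)) = {w a, w b} := by
    ext v; simpa using key v
  rw [this, Finset.card_pair hwne]
  exact even_two

/-- The face count of Sperner's lemma: a set with as many elements as there are colours has one
face with exactly the colours other than `i₀` if it carries all colours, and none or two
otherwise. -/
theorem odd_card_filter_erase_image_iff [Fintype I] [DecidableEq V] [DecidableEq I]
    (c : V → I) (i₀ : I) {R : Finset V} (hR : R.card = Fintype.card I) :
    Odd (R.filter fun x => (R.erase x).image c = Finset.univ.erase i₀).card ↔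
      R.image c = Finset.univ := by
  have hinj : ∀ x ∈ R, (R.erase x).image c = Finset.univ.erase i₀ →
      Set.InjOn c (R.erase x : Set V) := by
    intro x hx h
    refine Finset.injOn_of_card_image_eq ?_
    rw [h, Finset.card_erase_of_mem hx, Finset.card_erase_of_mem (Finset.mem_univ _), hR,
      Finset.card_univ]
  constructor
  · intro hodd
    by_contra hne
    obtain ⟨x, hx⟩ := Finset.card_pos.1 hodd.pos
    obtain ⟨hxR, hx⟩ := Finset.mem_filter.1 hx
    have hcx : c x ≠ i₀ := by
      intro h
      apply hne
      rw [← Finset.insert_erase hxR, Finset.image_insert, hx, h,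
        Finset.insert_erase (Finset.mem_univ _)]
    obtain ⟨z, hz, hcz⟩ : ∃ z ∈ R.erase x, c z = c x := by
      rw [← Finset.mem_image, hx]; simpa using hcx
    obtain ⟨hzx, hzR⟩ := Finset.mem_erase.1 hz
    -- The colours of `R.erase x` are distinct, so `x` and `z` are the only points of `R` of equal
    -- colour, and exactly these two can be removed without losing a colour.
    have : (R.filter fun x => (R.erase x).image c = Finset.univ.erase i₀) = {x, z} := by
      ext y
      simp only [Finset.mem_filter, Finset.mem_insert, Finset.mem_singleton]
      constructor
      · rintro ⟨hyR, hy⟩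
        by_contra! h
        exact hzx (hinj y hyR hy (by simpa using ⟨hzR, h.2.symm⟩)
          (by simpa using ⟨hxR, h.1.symm⟩) hcz)
      · rintro (rfl | rfl)
        · exact ⟨hxR, hx⟩
        · refine ⟨hzR, ?_⟩
          rw [← hx, ← Finset.insert_erase (Finset.mem_erase.2 ⟨hzx.symm, hxR⟩),
            Finset.image_insert, Finset.erase_right_comm, ← hcz, ← Finset.image_insert,
            Finset.insert_erase hz]
    rw [this, Finset.card_pair hzx.symm] at hodd
    exact absurd hodd (by decide)
  · intro h
    have hinjR : Set.InjOn c (R : Set V) :=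
      Finset.injOn_of_card_image_eq (by rw [h, hR, Finset.card_univ])
    obtain ⟨x, hxR, hx⟩ : ∃ x ∈ R, c x = i₀ := by
      rw [← Finset.mem_image, h]; exact Finset.mem_univ _
    have himg : ∀ y ∈ R, (R.erase y).image c = Finset.univ.erase (c y) := by
      intro y hy
      ext i
      simp only [Finset.mem_image, Finset.mem_erase, Finset.mem_univ, and_true]
      constructor
      · rintro ⟨z, ⟨hzy, hz⟩, rfl⟩ hc
        exact hzy (hinjR hz hy hc)
      · intro hi
        obtain ⟨z, hz, rfl⟩ : ∃ z ∈ R, c z = i := by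
          rw [← Finset.mem_image, h]; exact Finset.mem_univ _
        exact ⟨z, ⟨fun hzy => hi (by rw [hzy]), hz⟩, rfl⟩
    have : (R.filter fun x => (R.erase x).image c = Finset.univ.erase i₀) = {x} := by
      ext y
      simp only [Finset.mem_filter, Finset.mem_singleton]
      constructor
      · rintro ⟨hyR, hy⟩
        rw [himg y hyR] at hy
        refine hinjR hyR hxR ?_
        by_contra hne
        have : c y ∈ Finset.univ.erase i₀ :=
          Finset.mem_erase.2 ⟨fun h => hne (h.trans hx.symm), Finset.mem_univ _⟩
        rw [← hy] at this
        simp at this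
      · rintro rfl
        exact ⟨hxR, by rw [himg y hxR, hx]⟩
    rw [this, Finset.card_singleton]
    exact odd_one

/-- Scarf's lemma with slack elements `Sum.inr i`: in the order `i`, the slack element of `i` lies
below and every other slack element above all of `T`. The slack element of `i` has colour `i`. -/
theorem exists_dominant_image_eq_univ [LinearOrder L] {T : Type*} [Fintype T] [Nonempty T]
    [Fintype I] [Nonempty I] [DecidableEq I] [DecidableEq T]
    {κ : I → T ⊕ I → L} (hκ : ∀ i, Function.Injective (κ i))
    (hbot : ∀ i t, κ i (.inr i) < κ i (.inl t))
    (htop : ∀ i j t, i ≠ j → κ i (.inl t) < κ i (.inr j)) (c : T → I) :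
    ∃ R : Finset (T ⊕ I), IsDominant κ R ∧ R.image (Sum.elim c id) = Finset.univ := by
  classical
  obtain ⟨i₀⟩ := ‹Nonempty I›
  set n := Fintype.card I with hn
  have hnpos : 0 < n := Fintype.card_pos_iff.2 ⟨i₀⟩
  set col : T ⊕ I → I := Sum.elim c id with hcol
  let rooms : Finset (Finset (T ⊕ I)) :=
    Finset.univ.filter fun R => R.card = n ∧ IsDominant κ R
  let doors : Finset (Finset (T ⊕ I)) := Finset.univ.filter fun X =>
    X.card + 1 = n ∧ IsDominant κ X ∧ X.image col = Finset.univ.erase i₀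
  -- Both sides count the pairs of a room and a door contained in it.
  have hcount : ∑ R ∈ rooms, (R.filter fun x => (R.erase x).image col = Finset.univ.erase i₀).card
      = ∑ X ∈ doors, (Finset.univ.filter fun v => v ∉ X ∧ IsDominant κ (insert v X)).card := by
    rw [← Finset.card_sigma, ← Finset.card_sigma]
    refine Finset.card_bij' (fun p _ => ⟨p.1.erase p.2, p.2⟩) (fun p _ => ⟨insert p.2 p.1, p.2⟩)
      ?_ ?_ ?_ ?_
    · rintro ⟨R, x⟩ h
      simp only [rooms, doors, Finset.mem_sigma, Finset.mem_filter, Finset.mem_univ,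
        true_and] at h ⊢
      obtain ⟨⟨hc, hd⟩, hx, hi⟩ := h
      refine ⟨⟨?_, hd.mono (Finset.erase_subset _ _), hi⟩, Finset.notMem_erase _ _, ?_⟩
      · rw [Finset.card_erase_add_one hx, hc]
      · rwa [Finset.insert_erase hx]
    · rintro ⟨X, v⟩ h
      simp only [rooms, doors, Finset.mem_sigma, Finset.mem_filter, Finset.mem_univ,
        true_and] at h ⊢
      obtain ⟨⟨hc, hd, hi⟩, hv, hd'⟩ := h
      exact ⟨⟨by rw [Finset.card_insert_of_notMem hv, hc], hd'⟩, Finset.mem_insert_self _ _,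
        by rwa [Finset.erase_insert hv]⟩
    · rintro ⟨R, x⟩ h
      simp only [Finset.mem_sigma, Finset.mem_filter] at h
      simp [Finset.insert_erase h.2.1]
    · rintro ⟨X, v⟩ h
      simp only [Finset.mem_sigma, Finset.mem_filter] at h
      simp [Finset.erase_insert h.2.2.1]
  -- The only door without elements of `T`, which opens into a single room: the one obtained by
  -- adding the `κ i₀`-largest element of `T`.
  let X₀ : Finset (T ⊕ I) := (Finset.univ.erase i₀).image Sum.inr
  have hX₀mem : X₀ ∈ doors := by
    simp only [doors, Finset.mem_filter, Finset.mem_univ, true_and]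
    refine ⟨?_, ?_, ?_⟩
    · rw [Finset.card_image_of_injective _ Sum.inr_injective,
        Finset.card_erase_add_one (Finset.mem_univ _), Finset.card_univ]
    · rintro (t | j)
      · refine ⟨i₀, fun x hx => ?_⟩
        obtain ⟨j, hj, rfl⟩ := Finset.mem_image.1 hx
        exact (htop _ _ _ (Finset.mem_erase.1 hj).1.symm).le
      · refine ⟨j, fun x hx => ?_⟩
        obtain ⟨j', hj, rfl⟩ := Finset.mem_image.1 hx
        rcases eq_or_ne j j' with rfl | h
        · exact le_rfl
        · obtain ⟨t⟩ := ‹Nonempty T›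
          exact ((hbot j t).trans (htop j j' t h)).le
    · simp [X₀, Finset.image_image, hcol, Function.comp_def]
  have hX₀ : (Finset.univ.filter fun v => v ∉ X₀ ∧ IsDominant κ (insert v X₀)).card = 1 := by
    obtain ⟨t, -, ht⟩ := Finset.exists_max_image (Finset.univ : Finset T)
      (fun t => κ i₀ (.inl t)) Finset.univ_nonempty
    rw [Finset.card_eq_one]
    refine ⟨.inl t, ?_⟩
    ext v
    simp only [Finset.mem_filter, Finset.mem_univ, true_and, Finset.mem_singleton]
    have hlow : ∀ s w, (∃ i, ∀ x ∈ insert w X₀, κ i (.inl s) ≤ κ i x) →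
        κ i₀ (.inl s) ≤ κ i₀ w := by
      rintro s w ⟨i, hi⟩
      rcases eq_or_ne i i₀ with rfl | h
      · exact hi _ (Finset.mem_insert_self _ _)
      · exact absurd (hbot i s) (not_lt.2 (hi _ (Finset.mem_insert_of_mem
          (Finset.mem_image.2 ⟨i, by simpa using h, rfl⟩))))
    constructor
    · rintro ⟨hv, hd⟩
      have h := hlow t v (hd _)
      rcases v with s | j
      · exact hκ i₀ (le_antisymm (ht s (Finset.mem_univ _)) h)
      · have hj : j = i₀ := by
          by_contra hj
          exact hv (Finset.mem_image.2 ⟨j, by simpa using hj, rfl⟩)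
        subst hj
        exact absurd (hbot j t) (not_lt.2 h)
    · rintro rfl
      refine ⟨by simp [X₀], ?_⟩
      rintro (s | j)
      · refine ⟨i₀, fun x hx => ?_⟩
        rcases Finset.mem_insert.1 hx with rfl | hx
        · exact ht s (Finset.mem_univ _)
        · obtain ⟨j, hj, rfl⟩ := Finset.mem_image.1 hx
          exact (htop _ _ _ (Finset.mem_erase.1 hj).1.symm).le
      · refine ⟨j, ?_⟩
        rintro (s | j') -
        · exact (hbot j s).le
        · rcases eq_or_ne j j' with rfl | h
          · exact le_rfl
          · exact ((hbot j t).trans (htop j j' t h)).le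
  have heven : ∀ X ∈ doors.erase X₀,
      Even (Finset.univ.filter fun v => v ∉ X ∧ IsDominant κ (insert v X)).card := by
    intro X hX
    obtain ⟨hne, hX⟩ := Finset.mem_erase.1 hX
    simp only [doors, Finset.mem_filter, Finset.mem_univ, true_and] at hX
    obtain ⟨hc, hd, hi⟩ := hX
    have : ∃ t, Sum.inl t ∈ X := by
      by_contra! hno
      apply hne
      have himg : X = (X.image col).image Sum.inr := by
        rw [Finset.image_image]
        conv_lhs => rw [← Finset.image_id (s := X)]
        refine Finset.image_congr ?_
        rintro (t | j) hx
        · exact absurd hx (hno t)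
        · rfl
      rw [himg, hi]
    obtain ⟨t, ht⟩ := this
    exact even_card_filter_insert_dominant hκ hd hc ht Sum.inr fun i a h => htop i a t h
  have hodd : Odd (∑ R ∈ rooms,
      (R.filter fun x => (R.erase x).image col = Finset.univ.erase i₀).card) := by
    rw [hcount, ← Finset.add_sum_erase _ _ hX₀mem, hX₀]
    exact odd_one.add_even (Finset.even_sum _ heven)
  obtain ⟨R, hR, hRodd⟩ : ∃ R ∈ rooms,
      Odd (R.filter fun x => (R.erase x).image col = Finset.univ.erase i₀).card := by
    by_contra! h
    exact (Nat.not_even_iff_odd.2 hodd)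
      (Finset.even_sum _ fun R hR => Nat.not_odd_iff_even.1 (h R hR))
  simp only [rooms, Finset.mem_filter, Finset.mem_univ, true_and] at hR
  exact ⟨R, hR.2, (odd_card_filter_erase_image_iff col i₀ hR.1).1 hRodd⟩

/-- Scarf's lemma, for a finite set `T` preordered by the functions `h i` and coloured by `c`. -/
theorem exists_dominant_colored {T : Type*} [Fintype T] [Nonempty T] [Fintype I] [Nonempty I]
    [DecidableEq I] (h : I → T → ℕ) (c : T → I) :
    ∃ σ : Finset T, ∀ y, ∃ i ∈ σ.image c, ∀ x ∈ σ, h i y ≤ h i x := by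
  classical
  obtain ⟨B, hB⟩ : ∃ B, ∀ i t, h i t < B := by
    obtain ⟨B, hB⟩ := (Set.finite_range fun p : I × T => h p.1 p.2).bddAbove
    exact ⟨B + 1, fun i t => Nat.lt_succ_of_le (hB ⟨(i, t), rfl⟩)⟩
  -- Ties are broken by a fixed enumeration, in second place of a lexicographic order.
  let H : I → T ⊕ I → ℕ := fun i =>
    Sum.elim (fun t => h i t + 1) fun j => if j = i then 0 else B + 1
  let κ : I → T ⊕ I → ℕ ×ₗ Fin (Fintype.card (T ⊕ I)) :=
    fun i v => toLex (H i v, Fintype.equivFin _ v)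
  have hlt : ∀ i v w, H i v < H i w → κ i v < κ i w := fun i v w hvw =>
    Prod.Lex.toLex_lt_toLex.2 (Or.inl hvw)
  obtain ⟨R, hR, hcol⟩ := exists_dominant_image_eq_univ (κ := κ)
    (fun i v w hvw => (Fintype.equivFin _).injective (congrArg Prod.snd (toLex.injective hvw)))
    (fun i t => hlt _ _ _ (by simp [H]))
    (fun i j t hij => hlt _ _ _ (by simp [H, hij.symm, hB])) c
  refine ⟨R.preimage Sum.inl Sum.inl_injective.injOn, fun y => ?_⟩
  obtain ⟨i, hi⟩ := hR (.inl y)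
  obtain ⟨r, hr, hri⟩ : ∃ r ∈ R, Sum.elim c id r = i := by
    rw [← Finset.mem_image, hcol]; exact Finset.mem_univ _
  refine ⟨i, ?_, fun x hx => ?_⟩
  · rcases r with t | j
    · exact Finset.mem_image.2 ⟨t, by simpa using hr, hri⟩
    · obtain rfl : j = i := hri
      exact absurd (hi _ hr) (not_le.2 (hlt _ _ _ (by simp [H])))
  · by_contra! hlt'
    exact absurd (hi (.inl x) (by simpa using hx)) (not_le.2 (hlt _ _ _ (by simpa [H] using hlt')))

end Scarf

/-! ### Brouwer's fixed point theorem -/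

section Brouwer

variable {I : Type*} [Fintype I]

/-- An approximate fixed point of a self-map of the simplex, not assumed continuous: near `x` there
is, for every coordinate `i`, a point whose `i`-th coordinate is almost not decreased by `f`. -/
theorem exists_approx_le_image [Nonempty I] {f : (I → ℝ) → I → ℝ}
    (hf : Set.MapsTo f (stdSimplex ℝ I) (stdSimplex ℝ I)) {N : ℕ} (hN : 0 < N) :
    ∃ x ∈ stdSimplex ℝ I, ∀ i, ∃ y ∈ stdSimplex ℝ I,
      (∀ j, |x j - y j| ≤ (Fintype.card I : ℝ) / N) ∧
        y i - (Fintype.card I : ℝ) / N ≤ f y i := by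
  classical
  set d := Fintype.card I with hd
  have hN' : (0 : ℝ) < N := Nat.cast_pos.2 hN
  let T := {t : I → Fin (N + 1) // ∑ i, (t i : ℕ) = N}
  have hT : ∀ g : I → ℕ, ∑ i, g i = N → ∃ t : T, ∀ i, (t.1 i : ℕ) = g i := by
    intro g hg
    have hle : ∀ i, g i < N + 1 := fun i => Nat.lt_succ_of_le
      (hg ▸ Finset.single_le_sum (fun j _ => Nat.zero_le (g j)) (Finset.mem_univ i))
    exact ⟨⟨fun i => ⟨g i, hle i⟩, hg⟩, fun i => rfl⟩
  obtain ⟨i₀⟩ := ‹Nonempty I›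
  have : Nonempty T := ⟨(hT (Pi.single i₀ N) (by simp)).choose⟩
  have : Nonempty I := ⟨i₀⟩
  let pt : T → I → ℝ := fun t i => (t.1 i : ℕ) / (N : ℝ)
  have hpt : ∀ t, pt t ∈ stdSimplex ℝ I := fun t => by
    refine ⟨fun i => by positivity, ?_⟩
    rw [← Finset.sum_div, div_eq_one_iff_eq hN'.ne']
    exact_mod_cast t.2
  have hcol : ∀ t, ∃ i, pt t i ≤ f (pt t) i := by
    intro t
    by_contra! h
    have := Finset.sum_lt_sum_of_nonempty Finset.univ_nonempty fun i (_ : i ∈ Finset.univ) => h i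
    rw [(hf (hpt t)).2, (hpt t).2] at this
    exact lt_irrefl _ this
  choose c hc using hcol
  obtain ⟨σ, hσ⟩ := exists_dominant_colored (fun i (t : T) => (t.1 i : ℕ)) c
  have hne : σ.Nonempty := by
    obtain ⟨i, hi, -⟩ := hσ (Classical.arbitrary T)
    obtain ⟨t, ht, -⟩ := Finset.mem_image.1 hi
    exact ⟨t, ht⟩
  choose μ hμσ hμ using fun i => Finset.exists_min_image σ (fun t => (t.1 i : ℕ)) hne
  -- `m` is the coordinatewise minimum over `σ`, put to zero for the colours missing in `σ`. If the
  -- sum of `m` were at most `N - card I`, a grid point with coordinates above `m` would contradict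
  -- `hσ`; so the points of `σ`, which lie above `m` and have sum `N`, are close to `m`.
  let m : I → ℕ := fun i => if i ∈ σ.image c then ((μ i).1 i : ℕ) else 0
  have hm : ∀ s ∈ σ, ∀ j, m j ≤ (s.1 j : ℕ) := by
    intro s hs j
    by_cases hj : j ∈ σ.image c
    · simpa only [m, if_pos hj] using hμ j s hs
    · simp only [m, if_neg hj]; exact Nat.zero_le _
  have hsum : N < ∑ i, m i + d := by
    by_contra! hle
    have hsum' : ∑ i, (m i + 1) ≤ N := by
      simpa [Finset.sum_add_distrib, hd] using hle
    obtain ⟨t, ht⟩ := hT (fun i => m i + 1 + Pi.single (M := fun _ => ℕ) i₀ (N - ∑ i, (m i + 1)) i)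
      (by rw [Finset.sum_add_distrib, Finset.sum_pi_single']; simp; omega)
    obtain ⟨i, hi, hle⟩ := hσ t
    have h1 := hle (μ i) (hμσ i)
    have h2 := ht i
    simp only [m, if_pos hi] at h2
    omega
  have hm' : ∀ s ∈ σ, ∀ j, (s.1 j : ℕ) ≤ m j + d := by
    intro s hs j
    have h1 : (s.1 j : ℕ) - m j ≤ ∑ i, ((s.1 i : ℕ) - m i) :=
      Finset.single_le_sum (f := fun i => (s.1 i : ℕ) - m i) (fun _ _ => Nat.zero_le _)
        (Finset.mem_univ j)
    have h2 : ∑ i, ((s.1 i : ℕ) - m i) + ∑ i, m i = N := by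
      rw [← Finset.sum_add_distrib]
      exact (Finset.sum_congr rfl fun i _ => Nat.sub_add_cancel (hm s hs i)).trans s.2
    omega
  have hdist : ∀ s ∈ σ, ∀ t ∈ σ, ∀ j, |pt s j - pt t j| ≤ (d : ℝ) / N := by
    intro s hs t ht j
    have h1 := hm s hs j
    have h2 := hm' s hs j
    have h3 := hm t ht j
    have h4 := hm' t ht j
    have h5 : ((s.1 j : ℕ) : ℝ) ≤ (t.1 j : ℕ) + d := by exact_mod_cast (by omega)
    have h6 : ((t.1 j : ℕ) : ℝ) ≤ (s.1 j : ℕ) + d := by exact_mod_cast (by omega)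
    rw [← sub_div, abs_div, abs_of_pos hN']
    gcongr
    rw [abs_le]
    constructor <;> linarith
  obtain ⟨s, hs⟩ := hne
  refine ⟨pt s, hpt s, fun i => ?_⟩
  by_cases hi : i ∈ σ.image c
  · obtain ⟨t, ht, rfl⟩ := Finset.mem_image.1 hi
    exact ⟨pt t, hpt t, hdist s hs t ht, (sub_le_self _ (by positivity)).trans (hc t)⟩
  · refine ⟨pt s, hpt s, hdist s hs s hs, le_trans ?_ ((hf (hpt s)).1 i)⟩
    have h1 := hm' s hs i
    simp only [m, if_neg hi, zero_add] at h1
    rw [sub_nonpos]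
    simp only [pt]
    gcongr

/-- Brouwer's fixed point theorem for the standard simplex. -/
theorem exists_fixedPoint_stdSimplex [Nonempty I] {f : (I → ℝ) → I → ℝ}
    (hf : Set.MapsTo f (stdSimplex ℝ I) (stdSimplex ℝ I))
    (hcont : ContinuousOn f (stdSimplex ℝ I)) : ∃ x ∈ stdSimplex ℝ I, f x = x := by
  choose x hx y hy hxy hfy using fun n : ℕ => exists_approx_le_image hf n.succ_pos
  obtain ⟨a, ha, φ, hφ, hlim⟩ := (isCompact_stdSimplex ℝ I).tendsto_subseq hx
  refine ⟨a, ha, ?_⟩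
  have hε : Filter.Tendsto (fun n => (Fintype.card I : ℝ) / ((φ n).succ : ℕ)) Filter.atTop
      (nhds 0) :=
    ((tendsto_const_div_atTop_nhds_zero_nat (Fintype.card I : ℝ)).comp
      (Filter.tendsto_add_atTop_nat 1)).comp hφ.tendsto_atTop
  have hylim : ∀ i, Filter.Tendsto (fun n => y (φ n) i) Filter.atTop (nhds a) := by
    intro i
    rw [tendsto_pi_nhds] at hlim ⊢
    intro j
    have h0 : Filter.Tendsto (fun n => x (φ n) j - y (φ n) i j) Filter.atTop (nhds 0) :=
      squeeze_zero_norm (fun n => hxy (φ n) i j) hε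
    simpa using (hlim j).sub h0
  have hle : ∀ i, a i ≤ f a i := by
    intro i
    have h1 := (tendsto_pi_nhds.1 (hylim i) i).sub hε
    have h2 : Filter.Tendsto (fun n => f (y (φ n) i)) Filter.atTop (nhds (f a)) :=
      (hcont a ha).tendsto.comp (tendsto_nhdsWithin_iff.2
        ⟨hylim i, Filter.Eventually.of_forall fun n => hy (φ n) i⟩)
    rw [sub_zero] at h1
    exact le_of_tendsto_of_tendsto' h1 (tendsto_pi_nhds.1 h2 i) fun n => hfy (φ n) i
  have hsum : ∑ i, a i = ∑ i, f a i := by rw [ha.2, (hf ha).2]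
  funext i
  exact ((Finset.sum_eq_sum_iff_of_le fun i _ => hle i).1 hsum i (Finset.mem_univ i)).symm

/-- Brouwer's fixed point theorem for a product of standard simplices. -/
theorem exists_fixedPoint_pi_stdSimplex {ι : Type*} [Fintype ι] {S : ι → Type*}
    [∀ i, Fintype (S i)] [∀ i, Nonempty (S i)] {f : (∀ i, S i → ℝ) → ∀ i, S i → ℝ}
    (hf : ∀ σ, (∀ i, σ i ∈ stdSimplex ℝ (S i)) → ∀ i, f σ i ∈ stdSimplex ℝ (S i))
    (hcont : ContinuousOn f {σ | ∀ i, σ i ∈ stdSimplex ℝ (S i)}) :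
    ∃ σ, (∀ i, σ i ∈ stdSimplex ℝ (S i)) ∧ f σ = σ := by
  rcases isEmpty_or_nonempty ι with hι | hι
  · exact ⟨fun i => isEmptyElim i, fun i => isEmptyElim i, Subsingleton.elim _ _⟩
  set n : ℝ := (Fintype.card ι : ℝ) with hn
  have hnpos : 0 < n := Nat.cast_pos.2 Fintype.card_pos
  -- The product embeds into the simplex on the disjoint union by `e`, which gives every factor the
  -- mass `1 / n`. The retraction `r` of `e` normalizes the mass `A z i` of each factor; to avoid a
  -- division by zero it first adds a constant that vanishes as soon as this mass is at least `1 / n`.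
  let A : ((Σ i, S i) → ℝ) → ι → ℝ := fun z i => ∑ s, z ⟨i, s⟩
  let D : ((Σ i, S i) → ℝ) → ι → ℝ := fun z i => ∑ s : S i, (z ⟨i, s⟩ + max 0 (1 / n - A z i))
  let r : ((Σ i, S i) → ℝ) → ∀ i, S i → ℝ := fun z i s =>
    (z ⟨i, s⟩ + max 0 (1 / n - A z i)) / D z i
  let e : (∀ i, S i → ℝ) → (Σ i, S i) → ℝ := fun σ p => σ p.1 p.2 / n
  have hD : ∀ z ∈ stdSimplex ℝ (Σ i, S i), ∀ i, 0 < D z i := by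
    intro z hz i
    have hA : 0 ≤ A z i := Finset.sum_nonneg fun s _ => hz.1 _
    rcases hA.eq_or_lt with h0 | h0
    · refine Finset.sum_pos (fun s _ => ?_) Finset.univ_nonempty
      refine add_pos_of_nonneg_of_pos (hz.1 _) (lt_max_of_lt_right ?_)
      rw [← h0, sub_zero]; positivity
    · exact h0.trans_le (Finset.sum_le_sum fun s _ => le_add_of_nonneg_right (le_max_left _ _))
  have hr : ∀ z ∈ stdSimplex ℝ (Σ i, S i), ∀ i, r z i ∈ stdSimplex ℝ (S i) := fun z hz i =>
    ⟨fun s => div_nonneg (add_nonneg (hz.1 _) (le_max_left _ _)) (hD z hz i).le, by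
      simp only [r]
      rw [← Finset.sum_div]
      exact div_self (hD z hz i).ne'⟩
  have hrcont : ContinuousOn r (stdSimplex ℝ (Σ i, S i)) := by
    refine continuousOn_pi.2 fun i => continuousOn_pi.2 fun s => ?_
    refine ContinuousOn.div ?_ ?_ fun z hz => (hD z hz i).ne'
    · exact Continuous.continuousOn (by fun_prop)
    · exact Continuous.continuousOn (by fun_prop)
  have he : ∀ σ, (∀ i, σ i ∈ stdSimplex ℝ (S i)) → e σ ∈ stdSimplex ℝ (Σ i, S i) := by
    intro σ hσ
    refine ⟨fun p => div_nonneg ((hσ _).1 _) hnpos.le, ?_⟩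
    simp only [e]
    rw [Fintype.sum_sigma]
    simp only [← Finset.sum_div, (hσ _).2]
    simp [← hn, hnpos.ne']
  have hre : ∀ σ, (∀ i, σ i ∈ stdSimplex ℝ (S i)) → r (e σ) = σ := by
    intro σ hσ
    have hA : ∀ i, A (e σ) i = 1 / n := fun i => by
      simp only [A, e]
      rw [← Finset.sum_div, (hσ i).2]
    funext i s
    simp only [r, D, hA, sub_self, max_self, add_zero]
    change e σ ⟨i, s⟩ / A (e σ) i = σ i s
    rw [hA]
    simp only [e]
    field_simp
  have hecont : Continuous e := by fun_prop
  have : Nonempty (Σ i, S i) := hι.map fun i => ⟨i, Classical.arbitrary _⟩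
  obtain ⟨z, hz, hfix⟩ := exists_fixedPoint_stdSimplex (f := fun z => e (f (r z)))
    (fun z hz => he _ (hf _ (hr z hz)))
    (hecont.comp_continuousOn (hcont.comp hrcont hr))
  refine ⟨r z, hr z hz, ?_⟩
  conv_rhs => rw [← hfix]
  exact (hre _ (hf _ (hr z hz))).symm

end Brouwer

/-! ### Nash's theorem -/

section Nash

variable {ι : Type*} [Fintype ι] [DecidableEq ι] {S : ι → Type*} [∀ i, Fintype (S i)]

theorem continuous_expectedPayoff (M : (∀ i, S i) → ι → ℝ) (l : ι) :
    Continuous fun σ : ∀ i, S i → ℝ => expectedPayoff M σ l := by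
  unfold expectedPayoff
  fun_prop

/-- The expected payoff of a player is linear in the mixed strategy of this player. -/
theorem expectedPayoff_update [∀ i, DecidableEq (S i)] (M : (∀ i, S i) → ι → ℝ)
    (σ : ∀ i, S i → ℝ) (l : ι) (τ : S l → ℝ) :
    expectedPayoff M (Function.update σ l τ) l =
      ∑ s, τ s * expectedPayoff M (Function.update σ l (Pi.single s 1)) l := by
  have hprod : ∀ (ρ : S l → ℝ) (p : ∀ i, S i), ∏ i, Function.update σ l ρ i (p i) =
      ρ (p l) * ∏ i ∈ Finset.univ.erase l, σ i (p i) := by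
    intro ρ p
    rw [← Finset.mul_prod_erase _ _ (Finset.mem_univ l), Function.update_self]
    congr 1
    exact Finset.prod_congr rfl fun i hi => by
      rw [Function.update_of_ne (Finset.ne_of_mem_erase hi)]
  simp only [expectedPayoff, hprod, Finset.mul_sum]
  rw [Finset.sum_comm]
  refine Finset.sum_congr rfl fun p _ => ?_
  rw [Finset.sum_eq_single (p l)]
  · simp [mul_assoc]
  · intro s _ hs
    simp [Pi.single_eq_of_ne hs.symm]
  · simp

/-- Nash's theorem: every finite game has an equilibrium in mixed strategies. -/
theorem exists_isMixedNashEquilibrium [∀ i, Nonempty (S i)] (M : (∀ i, S i) → ι → ℝ) :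
    ∃ σ : ∀ i, S i → ℝ, IsMixedNashEquilibrium M σ := by
  classical
  let U : (∀ i, S i → ℝ) → ∀ l, S l → ℝ := fun σ l s =>
    expectedPayoff M (Function.update σ l (Pi.single s 1)) l
  let gain : (∀ i, S i → ℝ) → ∀ l, S l → ℝ := fun σ l s => max 0 (U σ l s - expectedPayoff M σ l)
  have hgain : ∀ σ l s, 0 ≤ gain σ l s := fun σ l s => le_max_left _ _
  have hpos : ∀ σ l, 0 < 1 + ∑ t, gain σ l t := fun σ l =>
    add_pos_of_pos_of_nonneg one_pos (Finset.sum_nonneg fun t _ => hgain σ l t)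
  have hgcont : ∀ l s, Continuous fun σ => gain σ l s := fun l s =>
    continuous_const.max (((continuous_expectedPayoff M l).comp
      (continuous_id.update l continuous_const)).sub (continuous_expectedPayoff M l))
  obtain ⟨σ, hσ, hfix⟩ := exists_fixedPoint_pi_stdSimplex
    (f := fun σ l s => (σ l s + gain σ l s) / (1 + ∑ t, gain σ l t))
    (fun σ hσ l => ⟨fun s => div_nonneg (add_nonneg ((hσ l).1 s) (hgain σ l s)) (hpos σ l).le, by
      rw [← Finset.sum_div, Finset.sum_add_distrib, (hσ l).2]
      exact div_self (hpos σ l).ne'⟩)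
    (Continuous.continuousOn (continuous_pi fun l => continuous_pi fun s =>
      Continuous.div (Continuous.fun_add (by fun_prop) (hgcont l s))
        (continuous_const.add (continuous_finsetSum _ fun t _ => hgcont l t))
        fun σ => (hpos σ l).ne'))
  refine ⟨σ, hσ, fun l τ hτ => ?_⟩
  have hmean : expectedPayoff M σ l = ∑ s, σ l s * U σ l s := by
    conv_lhs => rw [← Function.update_eq_self l σ]
    exact expectedPayoff_update M σ l (σ l)
  -- The present payoff is an average of the payoffs of the pure strategies in use, so one of these
  -- does not improve on it; the fixed point equation at this `s` makes the total gain vanish.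
  obtain ⟨s, hs, hUs⟩ : ∃ s, 0 < σ l s ∧ U σ l s ≤ expectedPayoff M σ l := by
    by_contra! h
    have hle : ∀ s ∈ Finset.univ, σ l s * expectedPayoff M σ l ≤ σ l s * U σ l s := fun s _ => by
      rcases ((hσ l).1 s).eq_or_lt with h0 | h0
      · simp [← h0]
      · exact mul_le_mul_of_nonneg_left (h s h0).le h0.le
    have heq := (Finset.sum_eq_sum_iff_of_le hle).1
      (by rw [← Finset.sum_mul, (hσ l).2, one_mul, ← hmean])
    obtain ⟨s, -, hs⟩ := Finset.exists_lt_of_sum_lt (s := Finset.univ) (f := fun _ : S l => (0 : ℝ))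
      (g := σ l) (by rw [(hσ l).2]; simp)
    exact (h s hs).ne (mul_left_cancel₀ hs.ne' (heq s (Finset.mem_univ s)))
  have hsum : ∑ t, gain σ l t = 0 := by
    have h1 : (σ l s + gain σ l s) / (1 + ∑ t, gain σ l t) = σ l s :=
      congrFun (congrFun hfix l) s
    have h2 : gain σ l s = 0 := max_eq_left (sub_nonpos.2 hUs)
    rw [div_eq_iff (hpos σ l).ne', h2] at h1
    have h3 : σ l s * ∑ t, gain σ l t = 0 := by linarith
    exact (mul_eq_zero.1 h3).resolve_left hs.ne'
  have hU : ∀ t, U σ l t ≤ expectedPayoff M σ l := fun t => by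
    have h := (Finset.sum_eq_zero_iff_of_nonneg fun t _ => hgain σ l t).1 hsum t (Finset.mem_univ t)
    exact sub_nonpos.1 (max_eq_left_iff.1 h)
  rw [expectedPayoff_update]
  calc ∑ t, τ t * U σ l t ≤ ∑ t, τ t * expectedPayoff M σ l :=
        Finset.sum_le_sum fun t _ => mul_le_mul_of_nonneg_left (hU t) (hτ.1 t)
    _ = expectedPayoff M σ l := by rw [← Finset.sum_mul, hτ.2, one_mul]

end Nash

theorem proposition2 {ι : Type*} [Fintype ι] [DecidableEq ι] {S : ι → Type*}
    [∀ i, Fintype (S i)] [∀ i, Nonempty (S i)] (g : CoarseGrainedGame ι S) (hg : g.UsesEMP)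
    (k : ι) :
    ∃ σ : ∀ i, S i → ℝ, IsMixedNashEquilibrium (g.preprocessedMatrix k) σ :=
  exists_isMixedNashEquilibrium (g.preprocessedMatrix k)
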